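/- Let $\alpha\in(1/2,2)\setminus\{1\}$ and $p\in(\alpha,2\alpha)\cap[1,2]$, and let $E=\ell^p(\mathbb Z)$ be the complex sequence space with canonical basis $(e_n)_{n\in\mathbb Z}$, continuous dual $E^*$ and bilinear duality bracket $\langle z,x^*\rangle=x^*(z)$. Let $(\omega_n)_{n\in\mathbb Z}$ be positive weights and $k_0\ge 0$ a constant such that the sequence $$k_n:=k_0\prod_{l=n+1}^{0}\frac1{\omega_l}\quad(n\le -1),\qquad k_n:=k_0\prod_{l=1}^{n}\omega_l\quad(n\ge 0),$$ belongs to $\ell^\alpha(\mathbb Z)$. Let $\mu$ be the $\alpha$-stable probability measure on the Borel sets of $E$ with characteristic functional $$\int_E e^{i\,\mathrm{Re}\langle z,x^*\rangle}\,\mu(dz)=\exp\Big(-\int_E|\mathrm{Re}\langle z,x^*\rangle|^\alpha\,\xi(dz)\Big),\quad x^*\in E^*,\qquad \xi:=\frac12\sum_{n\in\mathbb Z}k_n^\alpha\,(\delta_{e_n}+\delta_{ie_n}).$$ Let $T$ be the weighted forward shift $Te_n=\omega_{n+1}e_{n+1}$, $n\in\mathbb Z$, assumed to be a bounded linear operator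 on $E$, and let $T^*:E^*\to E^*$ be its adjoint, $\langle z,T^*x^*\rangle=\langle Tz,x^*\rangle$. Suppose that there are integers $q_-\ge0$ and $q_+\ge1$ with $$\eta_-:=\sup_{l\le -q_-}\frac1{\omega_l}<1,\qquad \eta_+:=\sup_{l\ge q_+}\omega_l<1,\qquad \eta_+^{p/2}\ne\eta_-^{\alpha-p/2}.$$ Let $\phi,\psi\in\{\mathrm{Re},-\mathrm{Re},\mathrm{Im},-\mathrm{Im}\}$ with $\phi\neq\psi$, and let $(a_j)_{j\ge0}$, $(b_l)_{l\ge0}$ be complex sequences in $\ell^1(\mathbb N)$ such that $$\sum_{j=0}^\infty|a_j|\,\|T\|^{jp/2}<\infty\quad\text{and}\quad\sum_{l=0}^\infty|b_l|\,\|T\|^{lp/2}<\infty.$$ Then, for all $x^*,y^*\in E^*$, the series $$f(z):=\sum_{j=0}^\infty a_je^{i\phi(\langle z,T^{*j}x^*\rangle)},\qquad g(z):=\sum_{l=0}^\infty b_le^{i\psi(\langle z,T^{*l}y^*\rangle)}$$ converge absolutely for every $z\in E$, the functions $f$ and $g$ belong to $L^2(E,\mu)$, the function $z\mapsto f(z)g(T^nz)$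 is $\mu$-integrable for every $n\ge0$, and $$I_n(f,g):=\int_E f(z)\,g(T^nz)\,\mu(dz)-\int_E f\,d\mu\int_E g\,d\mu$$ satisfies, for some constant $C>0$ that does not depend on $n$, $$|I_n(f,g)|\le C\,\max\big(\eta_-^{2\alpha/p-1},\,\eta_+\big)^{\alpha n/2},\qquad n\ge0.$$ -/

import Mathlib

open MeasureTheory

noncomputable section

namespace StableShift

/-- The complex Banach space `ℓ^p(ℤ)`. -/
abbrev EllP (p : ℝ) : Type := lp (fun _ : ℤ => ℂ) (ENNReal.ofReal p)

/-- The canonical basis vector `e_n` of `ℓ^p(ℤ)`. -/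
def e (p : ℝ) (n : ℤ) : EllP p := lp.single (ENNReal.ofReal p) n (1 : ℂ)

/-- `k_n = k₀ ∏_{l=n+1}^0 1/ω_l` for `n ≤ -1` and `k_n = k₀ ∏_{l=1}^n ω_l` for `n ≥ 0`. -/
def kSeq (k₀ : ℝ) (ω : ℤ → ℝ) (n : ℤ) : ℝ :=
  if n ≤ -1 then k₀ * ∏ l ∈ Finset.Icc (n + 1) 0, 1 / ω l
  else k₀ * ∏ l ∈ Finset.Icc 1 n, ω l

/-- The control measure `ξ = (1/2) ∑_{n ∈ ℤ} k_n^α (δ_{e_n} + δ_{i e_n})`. -/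
def controlMeasure (p α k₀ : ℝ) (ω : ℤ → ℝ) [Fact (1 ≤ ENNReal.ofReal p)]
    [MeasurableSpace (EllP p)] : Measure (EllP p) :=
  Measure.sum fun n : ℤ =>
    ENNReal.ofReal (1 / 2 * kSeq k₀ ω n ^ α) •
      (Measure.dirac (e p n) + Measure.dirac (Complex.I • e p n))

section Banach

variable {E : Type*} [NormedAddCommGroup E] [NormedSpace ℂ E]

/-- `μ` is the (symmetric) `α`-stable probability measure with control measure `ξ`: its
characteristic functional is `exp (-∫ |Re ⟨z, x*⟩|^α ξ(dz))`. -/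
structure IsStableWithControl [MeasurableSpace E] (α : ℝ) (ξ μ : Measure E) : Prop where
  isProbabilityMeasure : IsProbabilityMeasure μ
  charFunctional : ∀ x : E →L[ℂ] ℂ,
    ∫ z, Complex.exp (Complex.I * ((x z).re : ℂ)) ∂μ
      = Complex.exp (-((∫ z, |(x z).re| ^ α ∂ξ : ℝ) : ℂ))

/-- The adjoint `T* : E* → E*`, `⟨z, T* x*⟩ = ⟨T z, x*⟩`. -/
def adj (T : E →L[ℂ] E) (x : E →L[ℂ] ℂ) : E →L[ℂ] ℂ := x.comp T

/-- The term `a_j e^{i φ(⟨z, T^{*j} x*⟩)}`. -/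
def expTerm (φ : ℂ → ℝ) (T : E →L[ℂ] E) (a : ℕ → ℂ) (x : E →L[ℂ] ℂ) (z : E) (j : ℕ) : ℂ :=
  a j * Complex.exp (Complex.I * (φ (((adj T)^[j] x) z) : ℂ))

/-- The function `z ↦ ∑_{j ≥ 0} a_j e^{i φ(⟨z, T^{*j} x*⟩)}`. -/
def expSeries (φ : ℂ → ℝ) (T : E →L[ℂ] E) (a : ℕ → ℂ) (x : E →L[ℂ] ℂ) (z : E) : ℂ :=
  ∑' j : ℕ, expTerm φ T a x z j

/-- `I_n(f, g) = ∫ f(z) g(T^n z) μ(dz) - ∫ f dμ ∫ g dμ`. -/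
def corr [MeasurableSpace E] (μ : Measure E) (T : E →L[ℂ] E) (f g : E → ℂ) (n : ℕ) : ℂ :=
  (∫ z, f z * g ((T ^ n) z) ∂μ) - (∫ z, f z ∂μ) * ∫ z, g z ∂μ

end Banach

/-- `T` is the weighted forward shift `T e_n = ω_{n+1} e_{n+1}` on `ℓ^p(ℤ)`. A bounded operator is
determined by these values, as the `e_n` span a dense subspace. -/
def IsWeightedForwardShift {p : ℝ} [Fact (1 ≤ ENNReal.ofReal p)] (ω : ℤ → ℝ)
    (T : EllP p →L[ℂ] EllP p) : Prop :=
  ∀ n : ℤ, T (e p n) = (ω (n + 1) : ℂ) • e p (n + 1)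

/-- The four functions `Re`, `-Re`, `Im`, `-Im`. -/
def partFunctions : Set (ℂ → ℝ) :=
  {fun w => w.re, fun w => -w.re, fun w => w.im, fun w => -w.im}

end StableShift

end

/-! ### Elementary inequalities. -/

namespace StableShift

open Filter

/-! Write `Ψ(u)` for the exponent `∫ |Re ⟨z, u⟩| ^ α ξ(dz)`. Absolute convergence lets `I_n(f, g)`
be expanded as a double series of `a_j b_l (exp(-Ψ(u + v)) - exp(-Ψ(u)) exp(-Ψ(v)))`, with `u`, `v`
rotations of `T^{*j} x`, `T^{*(l+n)} y`. Here `T^n` has been moved onto `y`, and the mean of the `g`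
term is unaffected because `Ψ ∘ T* = Ψ`: the recursion `k_{m+1} = ω_{m+1} k_m` makes `T*` act on the
series for `Ψ` as a translation.

Each bracket is at most `|Ψ(u + v) - Ψ(u) - Ψ(v)|`, which is bounded coordinatewise through `|
|s+t|^α - |s|^α - |t|^α | ≤ 2 |s|^{α/2} |t|^{α/2}`. By the same translation this defect is at most a
constant times `∑_m k_{m+j}^{α/2} k_{m+l+n}^{α/2}`.

With `r = max(η₋^{2α/p-1}, η₊)` and `ρ = r^{α/2}`, the weights satisfy `k_i^{α/2} ≤ C ρ^i` on all of
`ℤ` and `∑ ρ^i k_i^{α/2} < ∞`, so the sum is `O(ρ^{n+l-j})`. The factor `ρ^{-j}` is absorbed by the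
summability of `|a_j| ‖T‖^{jp/2}`, since `ρ^{-1} ≤ ‖T‖^{p/2}`; what remains is `ρ^n`. -/

theorem abs_abs_add_rpow_sub_le {α : ℝ} (hα : 0 < α) (hα2 : α ≤ 2) (s t : ℝ) :
    |(|s + t| ^ α - |s| ^ α - |t| ^ α)| ≤ 2 * (|s| ^ (α / 2) * |t| ^ (α / 2)) := by
  have hsq : ∀ w : ℝ, |w| ^ α = (|w| ^ (α / 2)) ^ 2 := fun w => by
    rw [← Real.rpow_natCast, ← Real.rpow_mul (abs_nonneg w)]
    norm_num
  have hsub : ∀ v w : ℝ, |v + w| ^ (α / 2) ≤ |v| ^ (α / 2) + |w| ^ (α / 2) := fun v w =>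
    (Real.rpow_le_rpow (abs_nonneg _) (abs_add_le v w) (by linarith)).trans
      (Real.rpow_add_le_add_rpow (abs_nonneg _) (abs_nonneg _) (by linarith) (by linarith))
  -- Since `α / 2 ≤ 1`, the function `|·| ^ (α / 2)` is subadditive, so its values `A`, `a`, `B` at
  -- `s + t`, `s`, `t` obey all three triangle inequalities. Squaring `|a - B| ≤ A ≤ a + B` gives
  -- the claim.
  have h1 := hsub s t
  have h2 := hsub (s + t) (-t)
  have h3 := hsub (s + t) (-s)
  rw [add_neg_cancel_right, abs_neg] at h2
  rw [add_neg_cancel_comm, abs_neg] at h3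
  rw [hsq, hsq, hsq]
  have hA : 0 ≤ |s + t| ^ (α / 2) := by positivity
  have ha : 0 ≤ |s| ^ (α / 2) := by positivity
  have hB : 0 ≤ |t| ^ (α / 2) := by positivity
  generalize |s + t| ^ (α / 2) = A at *
  generalize |s| ^ (α / 2) = a at *
  generalize |t| ^ (α / 2) = B at *
  have h4 : (a - B) ^ 2 ≤ A ^ 2 := sq_le_sq' (by linarith) (by linarith)
  have h5 : A ^ 2 ≤ (a + B) ^ 2 := pow_le_pow_left₀ hA h1 2
  rw [abs_le]
  constructor <;> nlinarith

theorem norm_exp_neg_sub_exp_neg_le {A B : ℝ} (hA : 0 ≤ A) (hB : 0 ≤ B) :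
    |Real.exp (-A) - Real.exp (-B)| ≤ |A - B| := by
  wlog h : A ≤ B generalizing A B
  · rw [abs_sub_comm, abs_sub_comm A]
    exact this hB hA (le_of_not_ge h)
  have h1 : Real.exp (-B) ≤ Real.exp (-A) := Real.exp_le_exp.2 (by linarith)
  have h2 : Real.exp (-B) = Real.exp (-A) * Real.exp (A - B) := by
    rw [← Real.exp_add]; ring_nf
  have h3 := Real.add_one_le_exp (A - B)
  have h4 : Real.exp (-A) ≤ 1 := Real.exp_le_one_iff.2 (by linarith)
  have h5 := Real.exp_pos (-A)
  rw [abs_of_nonneg (by linarith), abs_of_nonpos (by linarith), h2]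
  nlinarith

/-! ### Two-sided sequences with geometric behaviour at both ends. -/

theorem bddAbove_of_eventually_succ_le {f : ℕ → ℝ} (h : ∀ᶠ n in atTop, f (n + 1) ≤ f n) :
    ∃ C, ∀ n, f n ≤ C := by
  obtain ⟨N, hN⟩ := eventually_atTop.1 h
  have hle : ∀ n, N ≤ n → f n ≤ f N := fun n hn => by
    induction n, hn using Nat.le_induction with
    | base => exact le_rfl
    | succ m hm ih => exact (hN m hm).trans ih
  refine ⟨∑ i ∈ Finset.range (N + 1), |f i|, fun n => ?_⟩
  have hs : ∀ m, m ≤ N → f m ≤ ∑ i ∈ Finset.range (N + 1), |f i| := fun m hm =>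
    (le_abs_self _).trans (Finset.single_le_sum (f := fun i => |f i|)
      (fun i _ => abs_nonneg _) (Finset.mem_range.2 (by omega)))
  rcases le_total n N with hn | hn
  · exact hs n hn
  · exact (hle n hn).trans (hs N le_rfl)

/-- If `K` is multiplied by at most `ρ < 1` at each step far to the right, and by at most `β < ρ`
at each step to the left far to the left, then `K i ≤ C ρ ^ i` on `ℤ`. -/
theorem exists_le_mul_zpow {K : ℤ → ℝ} {ρ β : ℝ} (hK : ∀ i, 0 ≤ K i) (hβ : 0 ≤ β) (hβρ : β < ρ)
    (hρ : ρ < 1) (hr : ∀ᶠ n : ℕ in atTop, K (n + 1) ≤ ρ * K n)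
    (hl : ∀ᶠ n : ℕ in atTop, K (-(n + 1 : ℤ)) ≤ β * K (-n)) :
    ∃ C, 0 ≤ C ∧ ∀ i, K i ≤ C * ρ ^ i := by
  have hρ0 : 0 < ρ := hβ.trans_lt hβρ
  obtain ⟨C₁, h₁⟩ := bddAbove_of_eventually_succ_le (f := fun n : ℕ => K n * ρ ^ (-(n : ℤ))) (by
    filter_upwards [hr] with n hn
    have : ρ ^ (-((n : ℤ) + 1)) = ρ ^ (-(n : ℤ)) * ρ⁻¹ := by
      rw [neg_add, zpow_add₀ hρ0.ne', zpow_neg_one]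
    push_cast
    rw [this]
    calc K (n + 1) * (ρ ^ (-(n : ℤ)) * ρ⁻¹) ≤ ρ * K n * (ρ ^ (-(n : ℤ)) * ρ⁻¹) := by gcongr
      _ = K n * ρ ^ (-(n : ℤ)) := by field_simp)
  obtain ⟨C₂, h₂⟩ := bddAbove_of_eventually_succ_le (f := fun n : ℕ => K (-n)) (by
    filter_upwards [hl] with n hn
    push_cast
    nlinarith [hK (-n)])
  refine ⟨max C₁ C₂, (hK _).trans ((h₂ 0).trans (le_max_right _ _)), fun i => ?_⟩
  have hm : (0 : ℝ) ≤ max C₁ C₂ := (hK _).trans ((h₂ 0).trans (le_max_right _ _))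
  rcases Int.eq_nat_or_neg i with ⟨n, rfl | rfl⟩
  · have := h₁ n
    simp only [zpow_neg] at this
    rw [← div_eq_mul_inv, div_le_iff₀ (by positivity)] at this
    exact this.trans (by gcongr; exact le_max_left _ _)
  -- On the left boundedness is enough, because `ρ ^ (-n) ≥ 1`.
  · have h3 : (1 : ℝ) ≤ ρ ^ (-(n : ℤ)) := by
      rw [zpow_neg]
      exact (one_le_inv₀ (by positivity)).2 (by
        rw [zpow_natCast]; exact pow_le_one₀ hρ0.le hρ.le)
    calc K (-n) ≤ max C₁ C₂ := (h₂ n).trans (le_max_right _ _)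
      _ ≤ _ := le_mul_of_one_le_right hm h3

/-- Ratio test on each half-line: the ratio is at most `ρ ^ 2` on the right and `β / ρ` on the left,
so the strict inequality `β < ρ` is essential. -/
theorem summable_zpow_mul {K : ℤ → ℝ} {ρ β : ℝ} (hK : ∀ i, 0 ≤ K i) (hβ : 0 ≤ β) (hβρ : β < ρ)
    (hρ : ρ < 1) (hr : ∀ᶠ n : ℕ in atTop, K (n + 1) ≤ ρ * K n)
    (hl : ∀ᶠ n : ℕ in atTop, K (-(n + 1 : ℤ)) ≤ β * K (-n)) :
    Summable fun i : ℤ => ρ ^ i * K i := by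
  have hρ0 : 0 < ρ := hβ.trans_lt hβρ
  have hnn : ∀ i : ℤ, 0 ≤ ρ ^ i * K i := fun i => mul_nonneg (by positivity) (hK i)
  refine Summable.of_nat_of_neg ?_ ?_
  · refine summable_of_ratio_norm_eventually_le (r := ρ * ρ) (by nlinarith) ?_
    filter_upwards [hr] with n hn
    rw [Real.norm_of_nonneg (hnn _), Real.norm_of_nonneg (hnn _)]
    push_cast
    rw [zpow_add_one₀ hρ0.ne']
    calc ρ ^ (n : ℤ) * ρ * K (n + 1) ≤ ρ ^ (n : ℤ) * ρ * (ρ * K n) := by gcongr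
      _ = _ := by ring
  · refine summable_of_ratio_norm_eventually_le (r := β / ρ) ((div_lt_one hρ0).2 hβρ) ?_
    filter_upwards [hl] with n hn
    rw [Real.norm_of_nonneg (hnn _), Real.norm_of_nonneg (hnn _)]
    push_cast
    have : ρ ^ (-((n : ℤ) + 1)) = ρ ^ (-(n : ℤ)) * ρ⁻¹ := by
      rw [neg_add, zpow_add₀ hρ0.ne', zpow_neg_one]
    rw [this]
    calc ρ ^ (-(n : ℤ)) * ρ⁻¹ * K (-(n + 1)) ≤ ρ ^ (-(n : ℤ)) * ρ⁻¹ * (β * K (-n)) := by gcongr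
      _ = _ := by ring

/-! ### The weights `k_n`. -/

section Weights

variable {k₀ : ℝ} {ω : ℤ → ℝ}

theorem kSeq_nonneg (hk₀ : 0 ≤ k₀) (hω : ∀ n, 0 < ω n) (n : ℤ) : 0 ≤ kSeq k₀ ω n := by
  unfold kSeq
  split_ifs
  · exact mul_nonneg hk₀ (Finset.prod_nonneg fun l _ => by have := hω l; positivity)
  · exact mul_nonneg hk₀ (Finset.prod_nonneg fun l _ => (hω l).le)

/-- A single recursion covers both product formulas; it is the source of the invariance under `T`.
-/
theorem kSeq_add_one (hω : ∀ n, 0 < ω n) (n : ℤ) :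
    kSeq k₀ ω (n + 1) = ω (n + 1) * kSeq k₀ ω n := by
  have h0 := (hω (n + 1)).ne'
  unfold kSeq
  rcases lt_trichotomy n (-1) with h | rfl | h
  · rw [if_pos (by omega), if_pos (by omega)]
    have : Finset.Icc (n + 1) 0 = insert (n + 1) (Finset.Icc (n + 1 + 1) 0) := by
      ext i; simp only [Finset.mem_Icc, Finset.mem_insert]; omega
    rw [this, Finset.prod_insert (by simp)]
    field_simp
  -- The junction `n = -1`, where the formulas give `k_{-1} = k₀ / ω_0`.
  · norm_num at h0 ⊢
    field_simp
  · rw [if_neg (by omega), if_neg (by omega)]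
    have : Finset.Icc 1 (n + 1) = insert (n + 1) (Finset.Icc 1 n) := by
      ext i; simp only [Finset.mem_Icc, Finset.mem_insert]; omega
    rw [this, Finset.prod_insert (by simp)]
    ring

theorem kSeq_rpow_eventually_right (hk₀ : 0 ≤ k₀) (hω : ∀ n, 0 < ω n) {q : ℤ} {η γ : ℝ}
    (hγ : 0 ≤ γ) (h : ∀ l, q ≤ l → ω l ≤ η) :
    ∀ᶠ n : ℕ in atTop, kSeq k₀ ω (n + 1) ^ γ ≤ η ^ γ * kSeq k₀ ω n ^ γ := by
  filter_upwards [eventually_ge_atTop q.toNat] with n hn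
  have hη : ω (n + 1) ≤ η := h _ (by omega)
  have := hω (n + 1)
  rw [kSeq_add_one hω, Real.mul_rpow this.le (kSeq_nonneg hk₀ hω _)]
  have := Real.rpow_nonneg (kSeq_nonneg hk₀ hω n) γ
  gcongr

theorem kSeq_rpow_eventually_left (hk₀ : 0 ≤ k₀) (hω : ∀ n, 0 < ω n) {q : ℤ} {η γ : ℝ}
    (hγ : 0 ≤ γ) (h : ∀ l, l ≤ -q → 1 / ω l ≤ η) :
    ∀ᶠ n : ℕ in atTop, kSeq k₀ ω (-(n + 1 : ℤ)) ^ γ ≤ η ^ γ * kSeq k₀ ω (-n) ^ γ := by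
  filter_upwards [eventually_ge_atTop q.toNat] with n hn
  have hη : 1 / ω (-n) ≤ η := h _ (by omega)
  have hp := hω (-n)
  have hs := kSeq_add_one (k₀ := k₀) hω (-(n + 1 : ℤ))
  rw [show -((n : ℤ) + 1) + 1 = -n by ring] at hs
  have hs' : kSeq k₀ ω (-(n + 1 : ℤ)) = 1 / ω (-n) * kSeq k₀ ω (-n) := by
    rw [hs]; field_simp
  rw [hs', Real.mul_rpow (by positivity) (kSeq_nonneg hk₀ hω _)]
  have := Real.rpow_nonneg (kSeq_nonneg hk₀ hω (-n)) γ
  gcongr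

end Weights

theorem adj_iterate_apply {E : Type*} [NormedAddCommGroup E] [NormedSpace ℂ E] (T : E →L[ℂ] E)
    (x : E →L[ℂ] ℂ) (j : ℕ) (z : E) : ((adj T)^[j] x) z = x ((T ^ j) z) := by
  induction j generalizing z with
  | zero => simp
  | succ j ih =>
    rw [Function.iterate_succ_apply', pow_succ]
    exact ih (T z)

/-- The scalars `c` for which `w ↦ Re (c w)` is one of `Re`, `-Re`, `Im`, `-Im`. -/
theorem exists_eq_re_mul {φ : ℂ → ℝ} (hφ : φ ∈ partFunctions) :
    ∃ c ∈ ({1, -1, Complex.I, -Complex.I} : Set ℂ), φ = fun w => (c * w).re := by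
  rcases hφ with rfl | rfl | rfl | rfl
  · exact ⟨1, by simp, by simp⟩
  · exact ⟨-1, by simp, by simp⟩
  · exact ⟨-Complex.I, by simp, by simp⟩
  · exact ⟨Complex.I, by simp, by simp⟩

end StableShift

namespace StableShift

open Filter

/-! ### The stable exponent: invariance and defect of additivity. -/

section Exponent

variable {p : ℝ} [Fact (1 ≤ ENNReal.ofReal p)] {α : ℝ} {k₀ : ℝ} {ω : ℤ → ℝ}

theorem norm_e (n : ℤ) : ‖e p n‖ = 1 := by
  have h1 : 1 ≤ p := ENNReal.one_le_ofReal.1 Fact.out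
  rw [e, lp.norm_single (by simpa using zero_lt_one.trans_le h1), norm_one]

theorem norm_apply_e_le (u : EllP p →L[ℂ] ℂ) (n : ℤ) : ‖u (e p n)‖ ≤ ‖u‖ := by
  simpa [norm_e] using u.le_opNorm (e p n)

/-- The contribution of the two atoms `e_m`, `i e_m` to `∫ |Re ⟨z, u⟩| ^ α ξ(dz)`. -/
noncomputable def exponentTerm (α k₀ : ℝ) (ω : ℤ → ℝ) (u : EllP p →L[ℂ] ℂ) (m : ℤ) : ℝ :=
  1 / 2 * kSeq k₀ ω m ^ α * (|(u (e p m)).re| ^ α + |(u (e p m)).im| ^ α)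

/-- The exponent `∫ |Re ⟨z, u⟩| ^ α ξ(dz)` of the characteristic functional, as a series. -/
noncomputable def stableExponent (α k₀ : ℝ) (ω : ℤ → ℝ) (u : EllP p →L[ℂ] ℂ) : ℝ :=
  ∑' m, exponentTerm α k₀ ω u m

theorem exponentTerm_nonneg (hk₀ : 0 ≤ k₀) (hω : ∀ n, 0 < ω n) (u : EllP p →L[ℂ] ℂ) (m : ℤ) :
    0 ≤ exponentTerm α k₀ ω u m := by
  have := kSeq_nonneg hk₀ hω m
  unfold exponentTerm
  positivity

theorem stableExponent_nonneg (hk₀ : 0 ≤ k₀) (hω : ∀ n, 0 < ω n) (u : EllP p →L[ℂ] ℂ) :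
    0 ≤ stableExponent α k₀ ω u :=
  tsum_nonneg fun m => exponentTerm_nonneg hk₀ hω u m

theorem summable_exponentTerm (hα : 0 ≤ α) (hk₀ : 0 ≤ k₀) (hω : ∀ n, 0 < ω n)
    (hk : Summable fun n : ℤ => kSeq k₀ ω n ^ α) (u : EllP p →L[ℂ] ℂ) :
    Summable (exponentTerm α k₀ ω u) := by
  refine Summable.of_nonneg_of_le (exponentTerm_nonneg hk₀ hω u) (fun m => ?_)
    (hk.mul_right (‖u‖ ^ α))
  have h1 : |(u (e p m)).re| ^ α ≤ ‖u‖ ^ α := by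
    have := (Complex.abs_re_le_norm _).trans (norm_apply_e_le u m)
    gcongr
  have h2 : |(u (e p m)).im| ^ α ≤ ‖u‖ ^ α := by
    have := (Complex.abs_im_le_norm _).trans (norm_apply_e_le u m)
    gcongr
  have h3 : 0 ≤ kSeq k₀ ω m ^ α := Real.rpow_nonneg (kSeq_nonneg hk₀ hω m) α
  calc exponentTerm α k₀ ω u m
      ≤ 1 / 2 * kSeq k₀ ω m ^ α * (‖u‖ ^ α + ‖u‖ ^ α) := by unfold exponentTerm; gcongr
    _ = _ := by ring

theorem integral_controlMeasure [MeasurableSpace (EllP p)] [BorelSpace (EllP p)] (hα : 0 < α)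
    (hk₀ : 0 ≤ k₀) (hω : ∀ n, 0 < ω n) (hk : Summable fun n : ℤ => kSeq k₀ ω n ^ α)
    (u : EllP p →L[ℂ] ℂ) :
    ∫ z, |(u z).re| ^ α ∂controlMeasure p α k₀ ω = stableExponent α k₀ ω u := by
  set F : EllP p → ℝ := fun z => |(u z).re| ^ α with hF
  have hFc : Continuous F :=
    (Complex.continuous_re.comp u.continuous).abs.rpow_const fun _ => Or.inr hα.le
  have hFm : StronglyMeasurable F := hFc.measurable.stronglyMeasurable
  have hint : ∀ z, Integrable F (Measure.dirac z) := fun z =>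
    integrable_dirac (by simp)
  have hk0 : ∀ m, 0 ≤ 1 / 2 * kSeq k₀ ω m ^ α := fun m => by
    have := kSeq_nonneg hk₀ hω m
    positivity
  have hterm : ∀ m : ℤ, ∫ z, F z ∂(ENNReal.ofReal (1 / 2 * kSeq k₀ ω m ^ α) •
      (Measure.dirac (e p m) + Measure.dirac (Complex.I • e p m))) = exponentTerm α k₀ ω u m := by
    intro m
    rw [integral_smul_measure, integral_add_measure (hint _) (hint _),
      integral_dirac' _ _ hFm, integral_dirac' _ _ hFm, ENNReal.toReal_ofReal (hk0 m)]
    simp [hF, exponentTerm]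
  have hintm : ∀ m : ℤ, Integrable F (ENNReal.ofReal (1 / 2 * kSeq k₀ ω m ^ α) •
      (Measure.dirac (e p m) + Measure.dirac (Complex.I • e p m))) := fun m =>
    ((hint _).add_measure (hint _)).smul_measure ENNReal.ofReal_ne_top
  have hnorm : ∀ z, ‖F z‖ = F z := fun z => Real.norm_of_nonneg (by positivity)
  have hI : Integrable F (controlMeasure p α k₀ ω) := by
    refine integrable_sum_measure hintm ?_
    simp only [hnorm, hterm]
    exact summable_exponentTerm hα.le hk₀ hω hk u
  have := hasSum_integral_measure hI
  simp only [hterm] at this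
  exact this.tsum_eq.symm

/-- The atoms `e_m` and `i e_m` have equal mass, and multiplying by such a `c` only permutes real
and imaginary parts up to sign. -/
theorem stableExponent_smul {c : ℂ} (hc : c ∈ ({1, -1, Complex.I, -Complex.I} : Set ℂ))
    (u : EllP p →L[ℂ] ℂ) : stableExponent α k₀ ω (c • u) = stableExponent α k₀ ω u := by
  unfold stableExponent exponentTerm
  rcases hc with rfl | rfl | rfl | rfl <;> simp [add_comm]

theorem apply_e_adj {T : EllP p →L[ℂ] EllP p} (hT : IsWeightedForwardShift ω T)
    (u : EllP p →L[ℂ] ℂ) (m : ℤ) : adj T u (e p m) = ω (m + 1) * u (e p (m + 1)) := by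
  simp [adj, hT m]

/-- The factor `ω_{m+1}` produced by `T*` combines with `k_m` into `k_{m+1}`, so the series is
merely translated. At the level of characteristic functionals, this says that `T` preserves the
stable law. -/
theorem stableExponent_adj (hk₀ : 0 ≤ k₀) (hω : ∀ n, 0 < ω n) {T : EllP p →L[ℂ] EllP p}
    (hT : IsWeightedForwardShift ω T) (u : EllP p →L[ℂ] ℂ) :
    stableExponent α k₀ ω (adj T u) = stableExponent α k₀ ω u := by
  unfold stableExponent
  rw [← (Equiv.addRight (1 : ℤ)).tsum_eq (exponentTerm α k₀ ω u)]
  refine tsum_congr fun m => ?_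
  have h := (hω (m + 1)).le
  rw [Equiv.coe_addRight, exponentTerm, exponentTerm, apply_e_adj hT, kSeq_add_one hω,
    Real.mul_rpow h (kSeq_nonneg hk₀ hω m), Complex.re_ofReal_mul, Complex.im_ofReal_mul,
    abs_mul, abs_mul, abs_of_nonneg h, Real.mul_rpow h (abs_nonneg _),
    Real.mul_rpow h (abs_nonneg _)]
  ring

theorem stableExponent_adj_iterate (hk₀ : 0 ≤ k₀) (hω : ∀ n, 0 < ω n) {T : EllP p →L[ℂ] EllP p}
    (hT : IsWeightedForwardShift ω T) (u : EllP p →L[ℂ] ℂ) (j : ℕ) :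
    stableExponent α k₀ ω ((adj T)^[j] u) = stableExponent α k₀ ω u := by
  induction j with
  | zero => rfl
  | succ j ih => rw [Function.iterate_succ_apply', stableExponent_adj hk₀ hω hT, ih]

theorem kSeq_mul_norm_adj_iterate (hω : ∀ n, 0 < ω n) {T : EllP p →L[ℂ] EllP p}
    (hT : IsWeightedForwardShift ω T) (u : EllP p →L[ℂ] ℂ) (j : ℕ) (m : ℤ) :
    kSeq k₀ ω m * ‖((adj T)^[j] u) (e p m)‖ = kSeq k₀ ω (m + j) * ‖u (e p (m + j))‖ := by
  induction j generalizing m with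
  | zero => simp
  | succ j ih =>
    rw [Function.iterate_succ_apply', apply_e_adj hT, norm_mul, Complex.norm_real,
      Real.norm_of_nonneg (hω _).le, ← mul_assoc, mul_comm _ (ω _), ← kSeq_add_one hω, ih]
    push_cast
    rw [add_right_comm, add_assoc]

/-- The scalar inequality is applied to real and imaginary parts; these two contributions cancel the
factor `1 / 2`, and `k_m ^ α` is shared equally between `u` and `v`. -/
theorem norm_exponentTerm_add_sub_le (hα : 0 < α) (hα2 : α ≤ 2) (hk₀ : 0 ≤ k₀)
    (hω : ∀ n, 0 < ω n) (u v : EllP p →L[ℂ] ℂ) (m : ℤ) :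
    |exponentTerm α k₀ ω (u + v) m - exponentTerm α k₀ ω u m - exponentTerm α k₀ ω v m| ≤
      2 * ((kSeq k₀ ω m * ‖u (e p m)‖) ^ (α / 2) * (kSeq k₀ ω m * ‖v (e p m)‖) ^ (α / 2)) := by
  have hk := kSeq_nonneg hk₀ hω m
  set s := u (e p m)
  set t := v (e p m)
  have hsq : kSeq k₀ ω m ^ α = kSeq k₀ ω m ^ (α / 2) * kSeq k₀ ω m ^ (α / 2) := by
    rw [← Real.rpow_add_of_nonneg hk (by linarith) (by linarith)]
    ring_nf
  have hre : |s.re| ^ (α / 2) * |t.re| ^ (α / 2) ≤ ‖s‖ ^ (α / 2) * ‖t‖ ^ (α / 2) := by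
    have := Complex.abs_re_le_norm s
    have := Complex.abs_re_le_norm t
    gcongr
  have him : |s.im| ^ (α / 2) * |t.im| ^ (α / 2) ≤ ‖s‖ ^ (α / 2) * ‖t‖ ^ (α / 2) := by
    have := Complex.abs_im_le_norm s
    have := Complex.abs_im_le_norm t
    gcongr
  have h1 := (abs_abs_add_rpow_sub_le hα hα2 s.re t.re).trans
    (mul_le_mul_of_nonneg_left hre zero_le_two)
  have h2 := (abs_abs_add_rpow_sub_le hα hα2 s.im t.im).trans
    (mul_le_mul_of_nonneg_left him zero_le_two)
  have h3 := (abs_add_le _ _).trans (add_le_add h1 h2)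
  have hka : 0 ≤ 1 / 2 * kSeq k₀ ω m ^ α := by positivity
  have heq : exponentTerm α k₀ ω (u + v) m - exponentTerm α k₀ ω u m - exponentTerm α k₀ ω v m =
      1 / 2 * kSeq k₀ ω m ^ α * (|s.re + t.re| ^ α - |s.re| ^ α - |t.re| ^ α +
        (|s.im + t.im| ^ α - |s.im| ^ α - |t.im| ^ α)) := by
    simp only [exponentTerm, add_apply, Complex.add_re, Complex.add_im]
    ring
  rw [heq, abs_mul, abs_of_nonneg hka, Real.mul_rpow hk (norm_nonneg _),
    Real.mul_rpow hk (norm_nonneg _)]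
  refine (mul_le_mul_of_nonneg_left h3 hka).trans_eq ?_
  rw [hsq]
  ring

theorem abs_stableExponent_add_sub_le (hα : 0 < α) (hα2 : α ≤ 2) (hk₀ : 0 ≤ k₀)
    (hω : ∀ n, 0 < ω n) (hk : Summable fun n : ℤ => kSeq k₀ ω n ^ α) (u v : EllP p →L[ℂ] ℂ)
    {B : ℤ → ℝ} (hB : Summable B)
    (h : ∀ m, (kSeq k₀ ω m * ‖u (e p m)‖) ^ (α / 2) * (kSeq k₀ ω m * ‖v (e p m)‖) ^ (α / 2)
      ≤ B m) :
    |stableExponent α k₀ ω (u + v) - stableExponent α k₀ ω u - stableExponent α k₀ ω v| ≤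
      2 * ∑' m, B m := by
  have hs := fun w : EllP p →L[ℂ] ℂ => (summable_exponentTerm hα.le hk₀ hω hk w).hasSum
  have hsum := ((hs (u + v)).sub (hs u)).sub (hs v)
  unfold stableExponent
  rw [← hsum.tsum_eq, ← tsum_mul_left, ← Real.norm_eq_abs]
  exact tsum_of_norm_bounded (hB.mul_left 2).hasSum fun m =>
    (norm_exponentTerm_add_sub_le hα hα2 hk₀ hω u v m).trans
      (mul_le_mul_of_nonneg_left (h m) zero_le_two)

/-- The dependence between the coordinates `T^{*j} x` and `T^{*l} y`, up to rotations, decays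
geometrically in `l - j`. -/
theorem exists_abs_stableExponent_add_sub_le (hα : 0 < α) (hα2 : α ≤ 2) (hk₀ : 0 ≤ k₀)
    (hω : ∀ n, 0 < ω n) (hk : Summable fun n : ℤ => kSeq k₀ ω n ^ α) {T : EllP p →L[ℂ] EllP p}
    (hT : IsWeightedForwardShift ω T) {ρ : ℝ} (hρ : 0 < ρ)
    (hle : ∃ C, 0 ≤ C ∧ ∀ i, kSeq k₀ ω i ^ (α / 2) ≤ C * ρ ^ i)
    (hsum : Summable fun i : ℤ => ρ ^ i * kSeq k₀ ω i ^ (α / 2))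
    {c d : ℂ} (hc : ‖c‖ = 1) (hd : ‖d‖ = 1) (x y : EllP p →L[ℂ] ℂ) :
    ∃ C, 0 ≤ C ∧ ∀ j l : ℕ,
      |stableExponent α k₀ ω (c • (adj T)^[j] x + d • (adj T)^[l] y)
        - stableExponent α k₀ ω (c • (adj T)^[j] x) - stableExponent α k₀ ω (d • (adj T)^[l] y)|
      ≤ C * (ρ ^ l * ρ⁻¹ ^ j) := by
  obtain ⟨C, hC, hCle⟩ := hle
  have hkn := kSeq_nonneg hk₀ hω
  set S := ∑' i : ℤ, ρ ^ i * kSeq k₀ ω i ^ (α / 2) with hS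
  have hS0 : 0 ≤ S := tsum_nonneg fun i => by
    have := hkn i
    positivity
  set D := C * (‖x‖ ^ (α / 2) * ‖y‖ ^ (α / 2)) with hD
  have hD0 : 0 ≤ D := by positivity
  refine ⟨2 * (D * S), by positivity, fun j l => ?_⟩
  set A := D * (ρ ^ l * ρ⁻¹ ^ j) with hA
  -- The weight at `m + j` is kept for summability, while the one at `m + l` is replaced by `C * ρ ^
  -- (m + l)`. Translation by `j` leaves the sum `S` unchanged.
  have hsj : HasSum (fun m : ℤ => A * (ρ ^ (m + j) * kSeq k₀ ω (m + j) ^ (α / 2))) (A * S) :=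
    ((Equiv.addRight (j : ℤ)).hasSum_iff.2 hsum.hasSum).mul_left A
  refine (abs_stableExponent_add_sub_le hα hα2 hk₀ hω hk _ _ hsj.summable fun m => ?_).trans_eq ?_
  · simp only [smul_apply, smul_eq_mul, norm_mul, hc, hd, one_mul]
    rw [kSeq_mul_norm_adj_iterate hω hT, kSeq_mul_norm_adj_iterate hω hT,
      Real.mul_rpow (hkn _) (norm_nonneg _), Real.mul_rpow (hkn _) (norm_nonneg _)]
    have h1 := norm_apply_e_le x (m + j)
    have h2 := norm_apply_e_le y (m + l)
    have h3 := hCle (m + l)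
    have h4 := Real.rpow_nonneg (hkn (m + j)) (α / 2)
    have h5 := Real.rpow_nonneg (hkn (m + l)) (α / 2)
    have hpow : ρ ^ (m + l) = ρ ^ (m + j) * (ρ ^ l * ρ⁻¹ ^ j) := by
      rw [zpow_add₀ hρ.ne', zpow_add₀ hρ.ne', zpow_natCast, zpow_natCast, inv_pow]
      field_simp
    calc _ ≤ kSeq k₀ ω (m + j) ^ (α / 2) * ‖x‖ ^ (α / 2) *
          (C * ρ ^ (m + l) * ‖y‖ ^ (α / 2)) := by gcongr
      _ = _ := by rw [hpow, hA, hD]; ring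
  · rw [hsj.tsum_eq, hA]
    ring

end Exponent

/-! ### Expansion of the correlation into a double series. -/

section Correlation

theorem norm_sub_mul_le_of_hasSum {F G : ℕ → ℂ} {H : ℕ × ℕ → ℂ} {u v w : ℂ} (hF : HasSum F u)
    (hG : HasSum G v) (hH : HasSum H w) (hFn : Summable fun j => ‖F j‖)
    (hGn : Summable fun l => ‖G l‖) {A B : ℕ → ℝ} (hA : Summable A) (hB : Summable B)
    (hA0 : ∀ j, 0 ≤ A j) (hB0 : ∀ l, 0 ≤ B l)
    (h : ∀ j l, ‖H (j, l) - F j * G l‖ ≤ A j * B l) :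
    ‖w - u * v‖ ≤ (∑' j, A j) * ∑' l, B l := by
  have hAB : Summable fun i : ℕ × ℕ => A i.1 * B i.2 := hA.mul_of_nonneg hB hA0 hB0
  have hFG : HasSum (fun i : ℕ × ℕ => F i.1 * G i.2) (u * v) :=
    hF.mul hG (summable_mul_of_summable_norm hFn hGn)
  rw [hA.tsum_mul_tsum hB hAB, ← (hH.sub hFG).tsum_eq]
  exact tsum_of_norm_bounded hAB.hasSum fun i => h i.1 i.2

variable {E : Type*} [NormedAddCommGroup E] [NormedSpace ℂ E]

theorem norm_expTerm (φ : ℂ → ℝ) (T : E →L[ℂ] E) (a : ℕ → ℂ) (x : E →L[ℂ] ℂ) (z : E) (j : ℕ) :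
    ‖expTerm φ T a x z j‖ = ‖a j‖ := by
  rw [expTerm, norm_mul, mul_comm Complex.I, Complex.norm_exp_ofReal_mul_I, mul_one]

theorem continuous_expSeries {φ : ℂ → ℝ} (hφ : Continuous φ) (T : E →L[ℂ] E) {a : ℕ → ℂ}
    (ha : Summable fun j => ‖a j‖) (x : E →L[ℂ] ℂ) : Continuous (expSeries φ T a x) := by
  refine continuous_tsum (fun j => ?_) ha fun j z => (norm_expTerm φ T a x z j).le
  unfold expTerm
  fun_prop

theorem norm_expSeries_le (φ : ℂ → ℝ) (T : E →L[ℂ] E) {a : ℕ → ℂ}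
    (ha : Summable fun j => ‖a j‖) (x : E →L[ℂ] ℂ) (z : E) :
    ‖expSeries φ T a x z‖ ≤ ∑' j, ‖a j‖ :=
  tsum_of_norm_bounded ha.hasSum fun j => (norm_expTerm φ T a x z j).le

variable [MeasurableSpace E]

theorem summable_norm_integral_expTerm {μ : Measure E} [IsFiniteMeasure μ] (φ : ℂ → ℝ)
    (T : E →L[ℂ] E) {a : ℕ → ℂ} (ha : Summable fun j => ‖a j‖) (x : E →L[ℂ] ℂ) :
    Summable fun j => ‖∫ z, expTerm φ T a x z j ∂μ‖ :=
  Summable.of_nonneg_of_le (fun _ => norm_nonneg _)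
    (fun j => norm_integral_le_of_norm_le_const (ae_of_all _ fun z =>
      (norm_expTerm φ T a x z j).le)) (ha.mul_right (μ.real Set.univ))

variable [BorelSpace E]

theorem hasSum_integral_expSeries {μ : Measure E} [IsFiniteMeasure μ] {φ : ℂ → ℝ}
    (hφ : Continuous φ) (T : E →L[ℂ] E) {a : ℕ → ℂ} (ha : Summable fun j => ‖a j‖)
    (x : E →L[ℂ] ℂ) :
    HasSum (fun j => ∫ z, expTerm φ T a x z j ∂μ) (∫ z, expSeries φ T a x z ∂μ) := by
  have hc : ∀ j, Continuous fun z => expTerm φ T a x z j := fun j => by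
    unfold expTerm
    fun_prop
  refine hasSum_integral_of_summable_integral_norm (fun j => ?_) ?_
  · exact Integrable.of_bound (hc j).measurable.aestronglyMeasurable ‖a j‖
      (ae_of_all _ fun z => (norm_expTerm φ T a x z j).le)
  · simp only [norm_expTerm, integral_const, smul_eq_mul]
    exact ha.mul_left _

theorem hasSum_integral_expSeries_mul {μ : Measure E} [IsFiniteMeasure μ] {φ ψ : ℂ → ℝ}
    (hφ : Continuous φ) (hψ : Continuous ψ) (T : E →L[ℂ] E) {a b : ℕ → ℂ}
    (ha : Summable fun j => ‖a j‖) (hb : Summable fun l => ‖b l‖) (x y : E →L[ℂ] ℂ) (n : ℕ) :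
    HasSum (fun i : ℕ × ℕ => ∫ z, expTerm φ T a x z i.1 * expTerm ψ T b y ((T ^ n) z) i.2 ∂μ)
      (∫ z, expSeries φ T a x z * expSeries ψ T b y ((T ^ n) z) ∂μ) := by
  have hc : ∀ i : ℕ × ℕ,
      Continuous fun z => expTerm φ T a x z i.1 * expTerm ψ T b y ((T ^ n) z) i.2 := fun i => by
    unfold expTerm
    fun_prop
  have hn : ∀ (i : ℕ × ℕ) (z : E),
      ‖expTerm φ T a x z i.1 * expTerm ψ T b y ((T ^ n) z) i.2‖ = ‖a i.1‖ * ‖b i.2‖ := fun i z => by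
    rw [norm_mul, norm_expTerm, norm_expTerm]
  have hs : ∀ z, expSeries φ T a x z * expSeries ψ T b y ((T ^ n) z) =
      ∑' i : ℕ × ℕ, expTerm φ T a x z i.1 * expTerm ψ T b y ((T ^ n) z) i.2 := fun z =>
    tsum_mul_tsum_of_summable_norm (by simpa only [norm_expTerm] using ha)
      (by simpa only [norm_expTerm] using hb)
  simp only [hs]
  refine hasSum_integral_of_summable_integral_norm (fun i => ?_) ?_
  · exact Integrable.of_bound (hc i).measurable.aestronglyMeasurable _
      (ae_of_all _ fun z => (hn i z).le)
  · simp only [hn, integral_const, smul_eq_mul]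
    exact (ha.mul_of_nonneg hb (fun _ => norm_nonneg _) fun _ => norm_nonneg _).mul_left _

theorem norm_corr_le {μ : Measure E} [IsFiniteMeasure μ] {φ ψ : ℂ → ℝ}
    (hφ : Continuous φ) (hψ : Continuous ψ) (T : E →L[ℂ] E) {a b : ℕ → ℂ}
    (ha : Summable fun j => ‖a j‖) (hb : Summable fun l => ‖b l‖) (x y : E →L[ℂ] ℂ) (n : ℕ)
    {A B : ℕ → ℝ} (hA : Summable A) (hB : Summable B) (hA0 : ∀ j, 0 ≤ A j) (hB0 : ∀ l, 0 ≤ B l)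
    (h : ∀ j l, ‖(∫ z, expTerm φ T a x z j * expTerm ψ T b y ((T ^ n) z) l ∂μ)
      - (∫ z, expTerm φ T a x z j ∂μ) * ∫ z, expTerm ψ T b y z l ∂μ‖ ≤ A j * B l) :
    ‖corr μ T (expSeries φ T a x) (expSeries ψ T b y) n‖ ≤ (∑' j, A j) * ∑' l, B l := by
  exact norm_sub_mul_le_of_hasSum (hasSum_integral_expSeries hφ T ha x)
    (hasSum_integral_expSeries hψ T hb y) (hasSum_integral_expSeries_mul hφ hψ T ha hb x y n)
    (summable_norm_integral_expTerm φ T ha x) (summable_norm_integral_expTerm ψ T hb y)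
    hA hB hA0 hB0 h

end Correlation

/-! ### Correlation of two exponentials under the stable law. -/

theorem integral_exp_re {p : ℝ} [Fact (1 ≤ ENNReal.ofReal p)] {α k₀ : ℝ} {ω : ℤ → ℝ}
    [MeasurableSpace (EllP p)] [BorelSpace (EllP p)] (hα : 0 < α)
    (hk₀ : 0 ≤ k₀) (hω : ∀ n, 0 < ω n) (hk : Summable fun n : ℤ => kSeq k₀ ω n ^ α)
    {μ : Measure (EllP p)} (hμ : IsStableWithControl α (controlMeasure p α k₀ ω) μ)
    (u : EllP p →L[ℂ] ℂ) :
    ∫ z, Complex.exp (Complex.I * ((u z).re : ℂ)) ∂μ =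
      (Real.exp (-stableExponent α k₀ ω u) : ℝ) := by
  rw [hμ.charFunctional, integral_controlMeasure hα hk₀ hω hk]
  push_cast
  rfl

/-- The correlation of two exponentials under a stable measure is controlled by the defect of
additivity of the exponent. -/
theorem norm_integral_expTerm_mul_sub_le {p : ℝ} [Fact (1 ≤ ENNReal.ofReal p)] {α k₀ : ℝ}
    {ω : ℤ → ℝ} [MeasurableSpace (EllP p)] [BorelSpace (EllP p)] (hα : 0 < α)
    (hk₀ : 0 ≤ k₀) (hω : ∀ n, 0 < ω n) (hk : Summable fun n : ℤ => kSeq k₀ ω n ^ α)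
    {μ : Measure (EllP p)} (hμ : IsStableWithControl α (controlMeasure p α k₀ ω) μ)
    {T : EllP p →L[ℂ] EllP p} (hT : IsWeightedForwardShift ω T) (a b : ℕ → ℂ) {c d : ℂ}
    (hd : d ∈ ({1, -1, Complex.I, -Complex.I} : Set ℂ)) (x y : EllP p →L[ℂ] ℂ) (n j l : ℕ) :
    ‖(∫ z, expTerm (fun w => (c * w).re) T a x z j *
        expTerm (fun w => (d * w).re) T b y ((T ^ n) z) l ∂μ)
      - (∫ z, expTerm (fun w => (c * w).re) T a x z j ∂μ) *
        ∫ z, expTerm (fun w => (d * w).re) T b y z l ∂μ‖ ≤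
    ‖a j‖ * ‖b l‖ * |stableExponent α k₀ ω (c • (adj T)^[j] x + d • (adj T)^[l + n] y)
        - stableExponent α k₀ ω (c • (adj T)^[j] x)
        - stableExponent α k₀ ω (d • (adj T)^[l + n] y)| := by
  have hint : ∀ (c : ℂ) (a : ℕ → ℂ) (x : EllP p →L[ℂ] ℂ) (j : ℕ),
      ∫ z, expTerm (fun w => (c * w).re) T a x z j ∂μ =
        a j * (Real.exp (-stableExponent α k₀ ω (c • (adj T)^[j] x)) : ℝ) := fun c a x j => by
    rw [← integral_exp_re hα hk₀ hω hk hμ, ← integral_const_mul]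
    rfl
  have hmul : ∀ z, expTerm (fun w => (c * w).re) T a x z j *
      expTerm (fun w => (d * w).re) T b y ((T ^ n) z) l = a j * b l * Complex.exp (Complex.I *
        (((c • (adj T)^[j] x + d • (adj T)^[l + n] y) z).re : ℂ)) := fun z => by
    have : ((adj T)^[l] y) ((T ^ n) z) = ((adj T)^[l + n] y) z := by
      rw [adj_iterate_apply, adj_iterate_apply, pow_add]
      rfl
    rw [expTerm, expTerm, this, mul_mul_mul_comm, ← Complex.exp_add]
    simp only [add_apply, smul_apply, smul_eq_mul,
      Complex.add_re, Complex.ofReal_add, mul_add]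
  -- Invariance replaces `l` by `l + n` in the mean of the second factor, so that the same
  -- functional occurs in both products.
  have hinv : stableExponent α k₀ ω (d • (adj T)^[l] y) =
      stableExponent α k₀ ω (d • (adj T)^[l + n] y) := by
    rw [stableExponent_smul hd, stableExponent_smul hd, stableExponent_adj_iterate hk₀ hω hT,
      stableExponent_adj_iterate hk₀ hω hT]
  simp only [hmul]
  rw [integral_const_mul, integral_exp_re hα hk₀ hω hk hμ, hint, hint, hinv, mul_mul_mul_comm,
    ← mul_sub, norm_mul, norm_mul, ← Complex.ofReal_mul, ← Real.exp_add, ← Complex.ofReal_sub,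
    Complex.norm_real, Real.norm_eq_abs]
  refine mul_le_mul_of_nonneg_left ?_ (by positivity)
  have h0 := fun u : EllP p →L[ℂ] ℂ => stableExponent_nonneg (α := α) hk₀ hω u
  rw [← neg_add, sub_sub]
  exact norm_exp_neg_sub_exp_neg_le (h0 _) (add_nonneg (h0 _) (h0 _))

end StableShift

/-! ### Comparison with the operator norm, and the conclusion. -/

namespace StableShift

theorem apply_le_opNorm {p : ℝ} [Fact (1 ≤ ENNReal.ofReal p)] {ω : ℤ → ℝ} (hω : ∀ n, 0 < ω n)
    {T : EllP p →L[ℂ] EllP p} (hT : IsWeightedForwardShift ω T) (n : ℤ) : ω n ≤ ‖T‖ := by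
  have := T.le_opNorm (e p (n - 1))
  rw [hT, norm_smul, sub_add_cancel, norm_e, norm_e, mul_one, mul_one, Complex.norm_real,
    Real.norm_of_nonneg (hω n).le] at this
  exact this

theorem continuous_of_mem_partFunctions {φ : ℂ → ℝ} (hφ : φ ∈ partFunctions) : Continuous φ := by
  obtain ⟨c, -, rfl⟩ := exists_eq_re_mul hφ
  fun_prop

theorem norm_eq_one_of_mem {c : ℂ} (hc : c ∈ ({1, -1, Complex.I, -Complex.I} : Set ℂ)) :
    ‖c‖ = 1 := by
  rcases hc with rfl | rfl | rfl | rfl <;> simp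

/-- As `ηm ≤ 1`, lowering an exponent raises the power: `ηm ^ (p / 2) ≤ ηm ^ (α / 2)`, and the
maximum is at least `ηm`. This lets powers of `ρ⁻¹` be paid for by powers of `‖T‖ ^ (p / 2)`. -/
theorem inv_rpow_max_le_rpow {α p ηm ηp t : ℝ} (hα : 0 < α) (hp : 0 < p) (hαp : α ≤ p)
    (hηm : 0 < ηm) (hηm1 : ηm ≤ 1) (ht : 1 / ηm ≤ t) :
    (max (ηm ^ (2 * α / p - 1)) ηp ^ (α / 2))⁻¹ ≤ t ^ (p / 2) := by
  have hθ : 2 * α / p - 1 ≤ 1 := by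
    rw [sub_le_iff_le_add, div_le_iff₀ hp]; linarith
  have h1 : ηm ^ (p / 2) ≤ max (ηm ^ (2 * α / p - 1)) ηp ^ (α / 2) := by
    calc ηm ^ (p / 2) ≤ ηm ^ (α / 2) := Real.rpow_le_rpow_of_exponent_ge hηm hηm1 (by linarith)
      _ ≤ _ := by
        refine Real.rpow_le_rpow hηm.le (le_max_of_le_left ?_) (by linarith)
        simpa using Real.rpow_le_rpow_of_exponent_ge hηm hηm1 hθ
  calc (max (ηm ^ (2 * α / p - 1)) ηp ^ (α / 2))⁻¹ ≤ (ηm ^ (p / 2))⁻¹ :=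
        inv_anti₀ (by positivity) h1
    _ = (1 / ηm) ^ (p / 2) := by rw [one_div, Real.inv_rpow hηm.le]
    _ ≤ t ^ (p / 2) := Real.rpow_le_rpow (by positivity) ht (by linarith)

end StableShift

theorem corollary5p3
    (α p : ℝ) (hα : 1 / 2 < α) (hα2 : α < 2) (hα1 : α ≠ 1)
    [Fact (1 ≤ ENNReal.ofReal p)] (hp2 : p ≤ 2) (hαp : α < p) (hpα : p < 2 * α)
    [MeasurableSpace (StableShift.EllP p)] [BorelSpace (StableShift.EllP p)]
    -- the weights and the control measure
    (ω : ℤ → ℝ) (hω : ∀ n, 0 < ω n) (k₀ : ℝ) (hk₀ : 0 ≤ k₀)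
    (hk : Summable fun n : ℤ => StableShift.kSeq k₀ ω n ^ α)
    (μ : MeasureTheory.Measure (StableShift.EllP p))
    (hμ : StableShift.IsStableWithControl α (StableShift.controlMeasure p α k₀ ω) μ)
    (T : StableShift.EllP p →L[ℂ] StableShift.EllP p)
    (hT : StableShift.IsWeightedForwardShift ω T)
    -- `η₋ = sup_{l ≤ -q₋} 1/ω_l < 1` and `η₊ = sup_{l ≥ q₊} ω_l < 1`
    (qm qp : ℤ) (hqm : 0 ≤ qm) (hqp : 1 ≤ qp) (ηm ηp : ℝ)
    (hηm : IsLUB ((fun l : ℤ => 1 / ω l) '' Set.Iic (-qm)) ηm) (hηm1 : ηm < 1)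
    (hηp : IsLUB (ω '' Set.Ici qp) ηp) (hηp1 : ηp < 1)
    (hne : ηp ^ (p / 2) ≠ ηm ^ (α - p / 2))
    -- the pair `(φ, ψ)`, the coefficients and the functionals
    (φ ψ : ℂ → ℝ) (hφ : φ ∈ StableShift.partFunctions) (hψ : ψ ∈ StableShift.partFunctions)
    (hφψ : φ ≠ ψ)
    (a b : ℕ → ℂ) (ha : Summable fun j => ‖a j‖) (hb : Summable fun l => ‖b l‖)
    (haT : Summable fun j : ℕ => ‖a j‖ * ‖T‖ ^ ((j : ℝ) * p / 2))
    (hbT : Summable fun l : ℕ => ‖b l‖ * ‖T‖ ^ ((l : ℝ) * p / 2))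
    (x y : StableShift.EllP p →L[ℂ] ℂ) :
    (∀ z, Summable fun j => ‖StableShift.expTerm φ T a x z j‖) ∧
    (∀ z, Summable fun l => ‖StableShift.expTerm ψ T b y z l‖) ∧
    MeasureTheory.MemLp (StableShift.expSeries φ T a x) 2 μ ∧
    MeasureTheory.MemLp (StableShift.expSeries ψ T b y) 2 μ ∧
    (∀ n : ℕ, MeasureTheory.Integrable
      (fun z => StableShift.expSeries φ T a x z * StableShift.expSeries ψ T b y ((T ^ n) z)) μ) ∧
    ∃ C : ℝ, 0 < C ∧ ∀ n : ℕ,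
      ‖StableShift.corr μ T (StableShift.expSeries φ T a x) (StableShift.expSeries ψ T b y) n‖
        ≤ C * max (ηm ^ (2 * α / p - 1)) ηp ^ (α * n / 2) := by

  have hα0 : 0 < α := by linarith
  have hp0 : 0 < p := by linarith
  have hprob := hμ.isProbabilityMeasure
  have hφc := StableShift.continuous_of_mem_partFunctions hφ
  have hψc := StableShift.continuous_of_mem_partFunctions hψ
  have hfc := StableShift.continuous_expSeries hφc T ha x
  have hgc := StableShift.continuous_expSeries hψc T hb y
  have hfb := StableShift.norm_expSeries_le φ T ha x
  have hgb := StableShift.norm_expSeries_le ψ T hb y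
  refine ⟨fun z => by simpa only [StableShift.norm_expTerm] using ha,
    fun z => by simpa only [StableShift.norm_expTerm] using hb,
    MemLp.of_bound hfc.measurable.aestronglyMeasurable _ (ae_of_all _ hfb),
    MemLp.of_bound hgc.measurable.aestronglyMeasurable _ (ae_of_all _ hgb),
    fun n => Integrable.of_bound
      (hfc.mul (hgc.comp (T ^ n).continuous)).measurable.aestronglyMeasurable
      ((∑' j, ‖a j‖) * ∑' l, ‖b l‖) (ae_of_all _ fun z => ?_), ?_⟩
  · rw [norm_mul]
    exact mul_le_mul (hfb z) (hgb _) (norm_nonneg _) ((norm_nonneg _).trans (hfb z))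
  have hm : ∀ l, l ≤ -qm → 1 / ω l ≤ ηm := fun l hl => hηm.1 ⟨l, hl, rfl⟩
  have hp : ∀ l, qp ≤ l → ω l ≤ ηp := fun l hl => hηp.1 ⟨l, hl, rfl⟩
  have hηm0 : 0 < ηm := (one_div_pos.2 (hω _)).trans_le (hm _ le_rfl)
  have hTn : 1 / ηm ≤ ‖T‖ := by
    rw [one_div_le hηm0 ((hω (-qm)).trans_le (StableShift.apply_le_opNorm hω hT _))]
    exact (one_div_le_one_div_of_le (hω _) (StableShift.apply_le_opNorm hω hT _)).trans
      (hm _ le_rfl)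
  set r := max (ηm ^ (2 * α / p - 1)) ηp with hr
  set ρ := r ^ (α / 2) with hρ
  have hθ0 : 0 < 2 * α / p - 1 := by
    rw [sub_pos, lt_div_iff₀ hp0]; linarith
  have hθ1 : 2 * α / p - 1 < 1 := by
    rw [sub_lt_iff_lt_add, div_lt_iff₀ hp0]; linarith
  -- Strictness comes from `α < p`, which makes the exponent less than `1`; it yields convergence at
  -- `-∞`. Dually, `p < 2 * α` makes the exponent positive, whence `r < 1`.
  have hηr : ηm < r := lt_max_of_lt_left (by
    simpa using Real.rpow_lt_rpow_of_exponent_gt hηm0 hηm1 hθ1)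
  have hr1 : r < 1 := max_lt (Real.rpow_lt_one hηm0.le hηm1 hθ0) hηp1
  have hr0 : 0 < r := hηm0.trans hηr
  have hρ0 : 0 < ρ := Real.rpow_pos_of_pos hr0 _
  have hρ1 : ρ < 1 := Real.rpow_lt_one hr0.le hr1 (by linarith)
  have hβρ : ηm ^ (α / 2) < ρ := Real.rpow_lt_rpow hηm0.le hηr (by linarith)
  have hρT : ρ⁻¹ ≤ ‖T‖ ^ (p / 2) :=
    StableShift.inv_rpow_max_le_rpow hα0 hp0 hαp.le hηm0 hηm1.le hTn
  have hK : ∀ i, 0 ≤ StableShift.kSeq k₀ ω i ^ (α / 2) := fun i =>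
    Real.rpow_nonneg (StableShift.kSeq_nonneg hk₀ hω i) _
  have hright := StableShift.kSeq_rpow_eventually_right (η := r) (γ := α / 2) hk₀ hω
    (by linarith) fun l hl => (hp l hl).trans (le_max_right _ _)
  have hleft := StableShift.kSeq_rpow_eventually_left (γ := α / 2) hk₀ hω (by linarith) hm
  have hβ0 : 0 ≤ ηm ^ (α / 2) := Real.rpow_nonneg hηm0.le _
  obtain ⟨c, hc, rfl⟩ := StableShift.exists_eq_re_mul hφ
  obtain ⟨d, hd, rfl⟩ := StableShift.exists_eq_re_mul hψ
  obtain ⟨C, hC, hCle⟩ := StableShift.exists_abs_stableExponent_add_sub_le hα0 hα2.le hk₀ hω hk hT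
    hρ0 (StableShift.exists_le_mul_zpow hK hβ0 hβρ hρ1 hright hleft)
    (StableShift.summable_zpow_mul hK hβ0 hβρ hρ1 hright hleft)
    (StableShift.norm_eq_one_of_mem hc) (StableShift.norm_eq_one_of_mem hd) x y
  have hpow : ∀ j : ℕ, ρ⁻¹ ^ j ≤ ‖T‖ ^ ((j : ℝ) * p / 2) := fun j => by
    have : (j : ℝ) * p / 2 = p / 2 * j := by ring
    rw [this, Real.rpow_mul (norm_nonneg T), Real.rpow_natCast]
    exact pow_le_pow_left₀ (by positivity) hρT j
  have hA0 : 0 ≤ ∑' j : ℕ, ‖a j‖ * ‖T‖ ^ ((j : ℝ) * p / 2) := tsum_nonneg fun j => by positivity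
  have hB0 : 0 ≤ ∑' l, ‖b l‖ := tsum_nonneg fun l => norm_nonneg _
  -- The `+ 1` only ensures positivity, since the product may vanish.
  refine ⟨C * ((∑' j : ℕ, ‖a j‖ * ‖T‖ ^ ((j : ℝ) * p / 2)) * ∑' l, ‖b l‖) + 1, by positivity,
    fun n => ?_⟩
  have hρn : r ^ (α * n / 2) = ρ ^ n := by
    rw [hρ, ← Real.rpow_natCast, ← Real.rpow_mul hr0.le]
    ring_nf
  rw [hρn]
  -- All of `C * ρ ^ n` and `‖T‖ ^ (j * p / 2)` goes into the `j` majorant; the extra decay `ρ ^ l`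
  -- is discarded, leaving `‖b l‖`.
  refine (StableShift.norm_corr_le (μ := μ) hφc hψc T ha hb x y n (haT.mul_left (C * ρ ^ n)) hb
    (fun j => by positivity) (fun l => norm_nonneg _) fun j l => ?_).trans ?_
  · refine (StableShift.norm_integral_expTerm_mul_sub_le hα0 hk₀ hω hk hμ hT a b hd x y
      n j l).trans ?_
    have hl : ρ ^ (l + n) ≤ ρ ^ n := pow_le_pow_of_le_one hρ0.le hρ1.le (Nat.le_add_left n l)
    calc ‖a j‖ * ‖b l‖ * _ ≤ ‖a j‖ * ‖b l‖ * (C * (ρ ^ (l + n) * ρ⁻¹ ^ j)) :=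
          mul_le_mul_of_nonneg_left (hCle j (l + n)) (by positivity)
      _ ≤ ‖a j‖ * ‖b l‖ * (C * (ρ ^ n * ‖T‖ ^ ((j : ℝ) * p / 2))) := by
          have := hpow j
          gcongr
      _ = _ := by ring
  · rw [tsum_mul_left]
    have : 0 < ρ ^ n := by positivity
    nlinarith
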